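/- Consider the $T$-node Gaussian multiple relay channel ($T \ge 2$): node $1$ is the source, node $T$ the destination, and $\mathcal R=\{2,\dots,T-1\}$ are the relays. Nodes $1,\dots,T-1$ send real inputs $X_1,\dots,X_{T-1}$, subject to the power constraints $E[X_i^2]\le P_i$ (with given $P_i\ge 0$), and nodes $j=2,\dots,T$ receive $$Y_j=\sum_{1\le i\le T-1,\ i\ne j}\sqrt{\lambda_{ij}}\,X_i+Z_j ,$$ where $\lambda_{ij}\ge 0$ are given path losses and the noises $Z_j\sim\mathcal N(0,N_j)$, $N_j>0$, are independent of each other and of the inputs. Write $X_{\mathcal R}=(X_i)_{i\in\mathcal R}$ and $Y_{\mathcal R}=(Y_j)_{j\in\mathcal R}$, and consider $$\max I(X_1;Y_{\mathcal R},Y_T\mid X_{\mathcal R}),\qquad(\ast)$$ the maximum being over all joint probability distributions of $(X_1,\dots,X_{T-1})$ that satisfy the power constraints. 1. Every input distribution that satisfies the power constraints, under which each $X_i$ is Gaussian, $X_1\sim\mathcal N(0,P_1)$ (zero mean, full power), and $X_1$ is independent of $X_{\mathcal R}$, attains the maximum $(\ast)$, which is finite. 2. In particular, mutually independent Gaussian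 inputs $X_1,\dots,X_{T-1}$ with $X_1\sim\mathcal N(0,P_1)$ and $E[X_i^2]\le P_i$ for all $i$ attain $(\ast)$. 3. Any correlation among the relay inputs is allowed: for every positive semidefinite matrix $S$ indexed by $\mathcal R$ with $S_{kk}\le P_k$ for all $k \in \mathcal R$, the inputs with $X_1\sim\mathcal N(0,P_1)$ independent of $X_{\mathcal R}\sim\mathcal N(0,S)$ attain $(\ast)$. -/

import Mathlib

open MeasureTheory ProbabilityTheory
open scoped NNReal ENNReal

noncomputable section

/-- Conditional mutual information `I(X; Y | Z)` (in nats) of random variables on a probability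
space `(Ω, μ)`, as the Kullback-Leibler divergence
`D(P_{Z,X,Y} ‖ P_Z ⊗ (P_{X|Z} × P_{Y|Z}))`, which makes sense for arbitrary laws. -/
def condMutualInfo {Ω α β γ : Type*} [MeasurableSpace Ω]
    [MeasurableSpace α] [StandardBorelSpace α] [Nonempty α]
    [MeasurableSpace β] [StandardBorelSpace β] [Nonempty β] [MeasurableSpace γ]
    (X : Ω → α) (Y : Ω → β) (Z : Ω → γ) (μ : Measure Ω) [IsFiniteMeasure μ] : ℝ≥0∞ :=
  InformationTheory.klDiv (μ.map (fun ω => (Z ω, X ω, Y ω)))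
    ((μ.map Z) ⊗ₘ ((condDistrib X Z μ) ×ₖ (condDistrib Y Z μ)))

/-- A Gaussian multiple relay channel with `r` relays, i.e. with `T = r + 2` nodes.
Nodes are the elements of `Fin (r + 2)`: node `0` is the source, the last node is the
destination, the others are the relays. The transmitting nodes are `i.castSucc` and the receiving
nodes are `j.succ`, for `i j : Fin (r + 1)`.
`gain i j` is the path loss `λ_{ij} ≥ 0` from node `i` to node `j` (for instance
`κ * d_{ij} ^ (-η)`, or `1` if path loss is ignored); `noiseVar j` is the noise variance at the
receiving node `j.succ`. -/
structure GaussianMRC (r : ℕ) where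
  gain : Fin (r + 2) → Fin (r + 2) → ℝ
  gain_nonneg : ∀ i j, i ≠ j → 0 ≤ gain i j
  noiseVar : Fin (r + 1) → ℝ≥0
  noiseVar_pos : ∀ j, 0 < noiseVar j

/-- The source input `X_1` as a function of the vector of all inputs. -/
def sourceInput {r : ℕ} (x : Fin (r + 1) → ℝ) : ℝ := x 0

/-- The vector `X_R` of relay inputs as a function of the vector of all inputs. -/
def relayInputs {r : ℕ} (x : Fin (r + 1) → ℝ) : Fin r → ℝ := fun k => x k.succ

namespace GaussianMRC

variable {r : ℕ}

/-- The received signals `Y_j = ∑_{i ≠ j} √λ_{ij} x_i + z_j` of all receiving nodes (all relays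
and the destination), for inputs `x` and noises `z`. -/
def output (C : GaussianMRC r) (x z : Fin (r + 1) → ℝ) : Fin (r + 1) → ℝ := fun j =>
  (∑ i : Fin (r + 1) with i.castSucc ≠ j.succ, √(C.gain i.castSucc j.succ) * x i) + z j

/-- The law of the noise vector: independent centered Gaussians. -/
def noise (C : GaussianMRC r) : Measure (Fin (r + 1) → ℝ) :=
  Measure.pi fun j => gaussianReal 0 (C.noiseVar j)

instance (C : GaussianMRC r) : IsProbabilityMeasure C.noise := by
  unfold noise; infer_instance

/-- `I(X_1; Y_R, Y_T | X_R)` when the inputs have joint law `μ` and the noise is independent of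
the inputs. -/
def cutInfo (C : GaussianMRC r) (μ : Measure (Fin (r + 1) → ℝ)) [IsProbabilityMeasure μ] :
    ℝ≥0∞ :=
  condMutualInfo (fun p => sourceInput p.1) (fun p => C.output p.1 p.2)
    (fun p => relayInputs p.1) (μ.prod C.noise)

/-- The power constraints `E[X_i ^ 2] ≤ P_i` for the joint input law `μ`. -/
def PowerConstraint (P : Fin (r + 1) → ℝ≥0) (μ : Measure (Fin (r + 1) → ℝ)) : Prop :=
  ∀ i, Integrable (fun x => x i ^ 2) μ ∧ ∫ x, x i ^ 2 ∂μ ≤ P i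

/-- The joint input law `μ` satisfies the power constraints and attains the (finite) maximum of
`I(X_1; Y_R, Y_T | X_R)` over all joint input laws satisfying them. -/
def AttainsMax (C : GaussianMRC r) (P : Fin (r + 1) → ℝ≥0)
    (μ : Measure (Fin (r + 1) → ℝ)) [IsProbabilityMeasure μ] : Prop :=
  PowerConstraint P μ ∧ C.cutInfo μ ≠ ∞ ∧
    ∀ (ν : Measure (Fin (r + 1) → ℝ)) [IsProbabilityMeasure ν],
      PowerConstraint P ν → C.cutInfo ν ≤ C.cutInfo μ

end GaussianMRC

/-- The input law under which `X_1 ∼ N(0, p)`, `X_R ∼ N(0, S)`, and these are independent. -/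
def correlatedRelayLaw {r : ℕ} (p : ℝ≥0) (S : Matrix (Fin r) (Fin r) ℝ) :
    Measure (Fin (r + 1) → ℝ) :=
  ((gaussianReal 0 p).prod (multivariateGaussian 0 S)).map
    (fun q : ℝ × EuclideanSpace ℝ (Fin r) => (Fin.cons q.1 (fun k => q.2 k) : Fin (r + 1) → ℝ))

instance {r : ℕ} (p : ℝ≥0) (S : Matrix (Fin r) (Fin r) ℝ) :
    IsProbabilityMeasure (correlatedRelayLaw p S) := by
  unfold correlatedRelayLaw
  refine Measure.isProbabilityMeasure_map (Measurable.aemeasurable ?_)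
  refine measurable_pi_iff.2 fun i => ?_
  refine Fin.cases ?_ (fun k => ?_) i
  · simpa using measurable_fst
  · simp only [Fin.cons_succ]
    fun_prop

end

/-!
Write `W` for the relay inputs and `Y` for the received signals. Given `W = w` and source input `x`,
`Y = b(w) + x • a + noise`, with `a` the vector of amplitudes from the source. By the Cameron-Martin
formula (`map_add_pi_gaussianReal`) its conditional law has an explicit density `exp φ` with respect
to the noise law, whatever the joint law of the inputs. Given `W`, the density of `Y` is then the
average `p` of `exp φ` over the conditional law of the source, and the information is the
expectation of `log (exp φ / p)`.

*Upper bound.* Let `exp ψ` be the average of `exp φ` when the source is an independent `N(0, P)`;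
it is computed in closed form by completing the square (`lintegral_exp_quadratic_gaussianReal`).
Since `exp ψ / p` has expectation `1` and `log u ≤ u - 1`, the information is at most the
expectation of `φ - ψ` (the golden formula, `HasChannelLogDensity.condMutualInfo_le`). No
integrability of `log p` has to be known beforehand. The relay signal `b(W)` cancels in `φ - ψ`, and
with `s = ∑ j, a j ^ 2 / N j` the expectation is
`log (1 + P s) / 2 + s (E[x ^ 2] - P) / (2 (1 + P s))` (`GaussianMRC.integral_channelLog_sub`), which
is at most `log (1 + P s) / 2` under the power constraint of the source.

*Attainment.* If the source is `N(0, P)` and independent of the relay inputs, then `p = exp ψ`, the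
golden formula is an equality (`HasChannelLogDensity.condMutualInfo_eq`), and `E[x ^ 2] = P`, so that
the bound is reached. The independent and the correlated Gaussian input laws are instances.
-/

noncomputable section

/-! ### Kullback-Leibler divergence of measures given by densities -/

/-- If `log (dM/dN) = h + log ρ` where `ρ` has `M`-integral at most `1`, then `D(M ‖ N) ≤ ∫ h dM`,
because `log ρ ≤ ρ - 1`. Integrability of the log-likelihood ratio is part of the conclusion: it
lies above `1 - dN/dM` and below `h + ρ - 1`, which are both integrable. -/
lemma klDiv_le_of_llr_eq {α : Type*} [MeasurableSpace α] {M N : Measure α}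
    [IsProbabilityMeasure M] [IsProbabilityMeasure N] (hac : M ≪ N) {h : α → ℝ}
    (hh : Integrable h M) {ρ : α → ℝ≥0∞} (hρ : AEMeasurable ρ M) (hρ0 : ∀ᵐ x ∂M, ρ x ≠ 0)
    (hρ1 : ∫⁻ x, ρ x ∂M ≤ 1)
    (hllr : llr M N =ᵐ[M] fun x => h x + Real.log (ρ x).toReal) :
    InformationTheory.klDiv M N ≤ ENNReal.ofReal (∫ x, h x ∂M) := by
  have hρfin : ∫⁻ x, ρ x ∂M ≠ ∞ := (hρ1.trans_lt ENNReal.one_lt_top).ne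
  have hρint : Integrable (fun x => (ρ x).toReal) M := integrable_toReal_of_lintegral_ne_top hρ hρfin
  have hρlt : ∀ᵐ x ∂M, ρ x < ∞ := ae_lt_top' hρ hρfin
  have hρle : ∫ x, (ρ x).toReal ∂M ≤ 1 := by
    rw [integral_toReal hρ hρlt]
    exact ENNReal.toReal_le_of_le_ofReal zero_le_one (by simpa using hρ1)
  have hub : ∀ᵐ x ∂M, llr M N x ≤ h x + ((ρ x).toReal - 1) := by
    filter_upwards [hllr, hρ0, hρlt] with x hx h0 hlt
    rw [hx]
    gcongr
    exact Real.log_le_sub_one_of_pos (ENNReal.toReal_pos h0 hlt.ne)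
  have hlb : ∀ᵐ x ∂M, 1 - (N.rnDeriv M x).toReal ≤ llr M N x := by
    filter_upwards [Measure.inv_rnDeriv hac, Measure.rnDeriv_pos hac,
      hac.ae_le (Measure.rnDeriv_lt_top M N)] with x hx h0 hlt
    rw [← hx, llr, Pi.inv_apply, ENNReal.toReal_inv]
    exact Real.one_sub_inv_le_log_of_pos (ENNReal.toReal_pos h0.ne' hlt.ne)
  have hint : Integrable (llr M N) M := by
    refine integrable_of_le_of_le (measurable_llr M N).aestronglyMeasurable hlb hub
      ((integrable_const 1).sub Measure.integrable_toReal_rnDeriv)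
      (hh.add (hρint.sub (integrable_const 1)))
  rw [InformationTheory.klDiv_of_ac_of_integrable hac hint]
  refine ENNReal.ofReal_le_ofReal ?_
  simp only [probReal_univ, add_sub_cancel_right]
  calc ∫ x, llr M N x ∂M ≤ ∫ x, (h x + ((ρ x).toReal - 1)) ∂M :=
        integral_mono_ae hint (hh.add (hρint.sub (integrable_const 1))) hub
    _ = ∫ x, h x ∂M + (∫ x, (ρ x).toReal ∂M - 1) := by
        have hsub : Integrable (fun x => (ρ x).toReal - 1) M := hρint.sub (integrable_const 1)
        rw [integral_add hh hsub, integral_sub hρint (integrable_const 1)]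
        simp
    _ ≤ ∫ x, h x ∂M := by linarith

lemma llr_withDensity_exp {α : Type*} [MeasurableSpace α] {ξ : Measure α} [SigmaFinite ξ]
    {φ : α → ℝ} (hφ : Measurable φ) {G : α → ℝ≥0∞} (hG : Measurable G)
    (hG0 : ∀ x, G x ≠ 0) (hGtop : ∀ᵐ x ∂ξ, G x ≠ ∞) :
    ξ.withDensity (fun x => ENNReal.ofReal (Real.exp (φ x))) ≪ ξ.withDensity G ∧
    llr (ξ.withDensity (fun x => ENNReal.ofReal (Real.exp (φ x)))) (ξ.withDensity G)
      =ᵐ[ξ] fun x => φ x - Real.log (G x).toReal := by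
  set F : α → ℝ≥0∞ := fun x => ENNReal.ofReal (Real.exp (φ x)) with hFdef
  have hF : Measurable F := by fun_prop
  have hac : ξ ≪ ξ.withDensity G :=
    withDensity_absolutelyContinuous' hG.aemeasurable (ae_of_all _ hG0)
  have hFG : ξ.withDensity F = (ξ.withDensity G).withDensity (F / G) := by
    rw [← withDensity_mul _ hG (hF.div hG)]
    refine withDensity_congr_ae ?_
    filter_upwards [hGtop] with x hx
    exact (ENNReal.mul_div_cancel (hG0 x) hx).symm
  have : SigmaFinite (ξ.withDensity G) := SigmaFinite.withDensity_of_ne_top hGtop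
  refine ⟨hFG ▸ withDensity_absolutelyContinuous _ _, ?_⟩
  have h := hac.ae_le (Measure.rnDeriv_withDensity (ξ.withDensity G) (hF.div hG))
  filter_upwards [h, hGtop] with x hx hxt
  rw [llr, hFG, hx, Pi.div_apply, ENNReal.toReal_div, Real.log_div, hFdef]
  · simp [ENNReal.toReal_ofReal (Real.exp_pos _).le]
  · simp [hFdef, ENNReal.toReal_ofReal (Real.exp_pos _).le]
  · exact (ENNReal.toReal_pos (hG0 x) hxt).ne'

/-! ### Conditional mutual information of a channel with a density -/

section Channel

variable {Ω α β γ : Type*} [MeasurableSpace Ω] [MeasurableSpace α] [StandardBorelSpace α]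
  [Nonempty α] [MeasurableSpace β] [MeasurableSpace γ]

/-- `exp (φ (z, x, ·))` is, for every `(z, x)`, a probability density with respect to `η`, and it is
the density of the conditional law of `Y` given `(Z, X) = (z, x)`. The latter is expressed through
expectations of nonnegative functions of `(Z, X, Y)`. Writing the density as an exponential makes it
positive and finite everywhere. -/
structure HasChannelLogDensity (X : Ω → α) (Y : Ω → β) (Z : Ω → γ) (μ : Measure Ω)
    (η : Measure β) (φ : γ × α × β → ℝ) : Prop where
  measurable : Measurable φ
  lintegral_exp : ∀ z x, ∫⁻ y, ENNReal.ofReal (Real.exp (φ (z, x, y))) ∂η = 1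
  lintegral_comp : ∀ g : γ × α × β → ℝ≥0∞, Measurable g →
    ∫⁻ ω, g (Z ω, X ω, Y ω) ∂μ =
      ∫⁻ ω, ∫⁻ y, g (Z ω, X ω, y) * ENNReal.ofReal (Real.exp (φ (Z ω, X ω, y))) ∂η ∂μ

variable {X : Ω → α} {Y : Ω → β} {Z : Ω → γ} {μ : Measure Ω} [IsProbabilityMeasure μ]
  {η : Measure β} [IsProbabilityMeasure η] {φ : γ × α × β → ℝ}

/-- The conditional density of `Y` given `Z = z` with respect to `η`: the channel density averaged
over the conditional law of `X` given `Z = z`. -/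
def mixtureDensity (X : Ω → α) (Z : Ω → γ) (μ : Measure Ω) [IsFiniteMeasure μ]
    (φ : γ × α × β → ℝ) (z : γ) (y : β) : ℝ≥0∞ :=
  ∫⁻ x, ENNReal.ofReal (Real.exp (φ (z, x, y))) ∂(condDistrib X Z μ z)

lemma measurable_mixtureDensity (hφ : Measurable φ) :
    Measurable (Function.uncurry (mixtureDensity X Z μ φ)) := by
  unfold Function.uncurry mixtureDensity
  have := Measurable.lintegral_kernel_prod_right' (κ := (condDistrib X Z μ).comap
    (Prod.fst : γ × β → γ) measurable_fst)
    (f := fun p : (γ × β) × α => ENNReal.ofReal (Real.exp (φ (p.1.1, p.2, p.1.2)))) (by fun_prop)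
  simpa using this

lemma mixtureDensity_ne_zero (hφ : Measurable φ) (z : γ) (y : β) :
    mixtureDensity X Z μ φ z y ≠ 0 := by
  unfold mixtureDensity
  rw [Ne, lintegral_eq_zero_iff (by fun_prop)]
  intro h
  have : ∀ᵐ x ∂(condDistrib X Z μ z), False := by
    filter_upwards [h] with x hx
    simp at hx
    exact absurd hx (not_le.2 (Real.exp_pos _))
  simp at this
  exact IsProbabilityMeasure.ne_zero _ this

lemma lintegral_map_condDistrib (hX : Measurable X) (hZ : Measurable Z) {g : γ × α → ℝ≥0∞}
    (hg : Measurable g) :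
    ∫⁻ ω, g (Z ω, X ω) ∂μ = ∫⁻ z, ∫⁻ x, g (z, x) ∂(condDistrib X Z μ z) ∂(μ.map Z) := by
  rw [← Measure.lintegral_compProd hg, compProd_map_condDistrib hX.aemeasurable,
    lintegral_map hg (hZ.prodMk hX)]

namespace HasChannelLogDensity

lemma lintegral_mixtureDensity (h : HasChannelLogDensity X Y Z μ η φ) (z : γ) :
    ∫⁻ y, mixtureDensity X Z μ φ z y ∂η = 1 := by
  have := h.measurable
  unfold mixtureDensity
  rw [lintegral_lintegral_swap (by fun_prop)]
  simp [h.lintegral_exp]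

lemma map_eq_withDensity (h : HasChannelLogDensity X Y Z μ η φ) (hX : Measurable X)
    (hY : Measurable Y) (hZ : Measurable Z) :
    μ.map (fun ω => (Z ω, X ω, Y ω)) =
      ((μ.map Z) ⊗ₘ ((condDistrib X Z μ) ×ₖ Kernel.const γ η)).withDensity
        (fun p => ENNReal.ofReal (Real.exp (φ p))) := by
  have hφ := h.measurable
  refine Measure.ext_of_lintegral _ fun g hg => ?_
  rw [lintegral_map hg (by fun_prop), h.lintegral_comp g hg,
    lintegral_withDensity_eq_lintegral_mul _ (by fun_prop) hg,
    Measure.lintegral_compProd (by fun_prop),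
    lintegral_map_condDistrib hX hZ (g := fun p : γ × α => ∫⁻ y, g (p.1, p.2, y) *
      ENNReal.ofReal (Real.exp (φ (p.1, p.2, y))) ∂η)
      (Measurable.lintegral_prod_right' (f := fun q : (γ × α) × β => g (q.1.1, q.1.2, q.2) *
      ENNReal.ofReal (Real.exp (φ (q.1.1, q.1.2, q.2)))) (by fun_prop))]
  refine lintegral_congr fun z => ?_
  rw [Kernel.prod_apply, lintegral_prod _ (by fun_prop)]
  simp [mul_comm]

variable [StandardBorelSpace β] [Nonempty β]

lemma condDistrib_eq (h : HasChannelLogDensity X Y Z μ η φ) (hX : Measurable X)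
    (hY : Measurable Y) (hZ : Measurable Z) :
    ∀ᵐ z ∂(μ.map Z), condDistrib Y Z μ z = η.withDensity (mixtureDensity X Z μ φ z) := by
  have hφ := h.measurable
  have hm := measurable_mixtureDensity (X := X) (Z := Z) (μ := μ) hφ
  set κ : Kernel γ β := (Kernel.const γ η).withDensity (mixtureDensity X Z μ φ) with hκ
  have hκa : ∀ z, κ z = η.withDensity (mixtureDensity X Z μ φ z) := fun z => by
    rw [hκ, Kernel.withDensity_apply _ hm, Kernel.const_apply]
  have : IsMarkovKernel κ := ⟨fun z => ⟨by
    rw [hκa, withDensity_apply _ .univ, Measure.restrict_univ, h.lintegral_mixtureDensity]⟩⟩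
  have key := condDistrib_ae_eq_of_measure_eq_compProd (μ := μ) (κ := κ) Z hY.aemeasurable ?_
  · filter_upwards [key] with z hz
    rw [hz, hκa]
  refine Measure.ext_of_lintegral _ fun g hg => ?_
  rw [lintegral_map hg (by fun_prop), Measure.lintegral_compProd hg,
    h.lintegral_comp (fun p => g (p.1, p.2.2)) (by fun_prop),
    lintegral_map_condDistrib hX hZ (g := fun p : γ × α => ∫⁻ y, g (p.1, y) *
      ENNReal.ofReal (Real.exp (φ (p.1, p.2, y))) ∂η)
      (Measurable.lintegral_prod_right' (f := fun q : (γ × α) × β => g (q.1.1, q.2) *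
      ENNReal.ofReal (Real.exp (φ (q.1.1, q.1.2, q.2)))) (by fun_prop))]
  refine lintegral_congr fun z => ?_
  rw [hκa, lintegral_withDensity_eq_lintegral_mul _ (by fun_prop) (by fun_prop),
    lintegral_lintegral_swap (by fun_prop)]
  refine lintegral_congr fun y => ?_
  simp only [Pi.mul_apply]
  rw [lintegral_const_mul _ (by fun_prop), mul_comm]
  rfl

lemma compProd_eq_withDensity (h : HasChannelLogDensity X Y Z μ η φ) (hX : Measurable X)
    (hY : Measurable Y) (hZ : Measurable Z) :
    (μ.map Z) ⊗ₘ ((condDistrib X Z μ) ×ₖ (condDistrib Y Z μ)) =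
      ((μ.map Z) ⊗ₘ ((condDistrib X Z μ) ×ₖ Kernel.const γ η)).withDensity
        (fun p => mixtureDensity X Z μ φ p.1 p.2.2) := by
  have hm := measurable_mixtureDensity (X := X) (Z := Z) (μ := μ) h.measurable
  have hm' : Measurable fun p : γ × α × β => mixtureDensity X Z μ φ p.1 p.2.2 :=
    hm.comp (measurable_fst.prodMk measurable_snd.snd)
  refine Measure.ext_of_lintegral _ fun g hg => ?_
  rw [lintegral_withDensity_eq_lintegral_mul _ hm' hg, Measure.lintegral_compProd hg,
    Measure.lintegral_compProd (hm'.mul hg)]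
  refine lintegral_congr_ae ?_
  filter_upwards [h.condDistrib_eq hX hY hZ] with z hz
  rw [Kernel.prod_apply, Kernel.prod_apply, lintegral_prod _ (by fun_prop),
    lintegral_prod _ (Measurable.aemeasurable (by fun_prop)), hz]
  refine lintegral_congr fun x => ?_
  rw [lintegral_withDensity_eq_lintegral_mul _ (by fun_prop) (by fun_prop)]
  rfl

/-- The log-likelihood ratio defining `I(X; Y | Z)` is the log-ratio of the conditional densities
of `Y` given `(Z, X)` and given `Z`. -/
lemma llr_eq (h : HasChannelLogDensity X Y Z μ η φ) (hX : Measurable X)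
    (hY : Measurable Y) (hZ : Measurable Z) :
    μ.map (fun ω => (Z ω, X ω, Y ω)) ≪
      (μ.map Z) ⊗ₘ ((condDistrib X Z μ) ×ₖ (condDistrib Y Z μ)) ∧
    (∀ᵐ p ∂(μ.map fun ω => (Z ω, X ω, Y ω)), mixtureDensity X Z μ φ p.1 p.2.2 ≠ ∞) ∧
    llr (μ.map (fun ω => (Z ω, X ω, Y ω)))
      ((μ.map Z) ⊗ₘ ((condDistrib X Z μ) ×ₖ (condDistrib Y Z μ)))
      =ᵐ[μ.map fun ω => (Z ω, X ω, Y ω)]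
        fun p => φ p - Real.log (mixtureDensity X Z μ φ p.1 p.2.2).toReal := by
  have hm := measurable_mixtureDensity (X := X) (Z := Z) (μ := μ) h.measurable
  have hm' : Measurable fun p : γ × α × β => mixtureDensity X Z μ φ p.1 p.2.2 :=
    hm.comp (measurable_fst.prodMk measurable_snd.snd)
  have := Measure.isProbabilityMeasure_map (μ := μ) hZ.aemeasurable
  have hfin : ∀ᵐ p ∂((μ.map Z) ⊗ₘ ((condDistrib X Z μ) ×ₖ Kernel.const γ η)),
      mixtureDensity X Z μ φ p.1 p.2.2 ≠ ∞ := by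
    have h1 : ∫⁻ p, mixtureDensity X Z μ φ p.1 p.2.2
        ∂((μ.map Z) ⊗ₘ ((condDistrib X Z μ) ×ₖ Kernel.const γ η)) = 1 := by
      have := congrArg (fun m => m Set.univ) (h.compProd_eq_withDensity hX hY hZ)
      simpa [withDensity_apply _ MeasurableSet.univ] using this.symm
    filter_upwards [ae_lt_top hm' (by simp [h1])] with p hp using hp.ne
  obtain ⟨h1, h2⟩ := llr_withDensity_exp h.measurable hm'
    (fun p => mixtureDensity_ne_zero h.measurable p.1 p.2.2) hfin
  rw [h.compProd_eq_withDensity hX hY hZ, h.map_eq_withDensity hX hY hZ]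
  have hac := withDensity_absolutelyContinuous
    ((μ.map Z) ⊗ₘ ((condDistrib X Z μ) ×ₖ Kernel.const γ η))
    (fun p => ENNReal.ofReal (Real.exp (φ p)))
  exact ⟨h1, hac.ae_le hfin, hac.ae_le h2⟩

/-- Golden formula, as an upper bound: `I(X; Y | Z)` is at most the expected log-ratio of the
channel density and of an arbitrary conditional (sub-)density `exp (ψ (z, ·))`. If `p` denotes the
conditional density of `Y` given `Z`, the two sides differ by the expectation of
`log (exp ψ / p)`, and `exp ψ / p` has expectation at most `1`. -/
theorem condMutualInfo_le (h : HasChannelLogDensity X Y Z μ η φ) (hX : Measurable X)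
    (hY : Measurable Y) (hZ : Measurable Z) {ψ : γ × β → ℝ} (hψ : Measurable ψ)
    (hψ1 : ∀ z, ∫⁻ y, ENNReal.ofReal (Real.exp (ψ (z, y))) ∂η ≤ 1)
    (hint : Integrable (fun ω => φ (Z ω, X ω, Y ω) - ψ (Z ω, Y ω)) μ) :
    condMutualInfo X Y Z μ ≤
      ENNReal.ofReal (∫ ω, φ (Z ω, X ω, Y ω) - ψ (Z ω, Y ω) ∂μ) := by
  have hφ := h.measurable
  have hm := measurable_mixtureDensity (X := X) (Z := Z) (μ := μ) h.measurable
  have hm' : Measurable fun p : γ × α × β => mixtureDensity X Z μ φ p.1 p.2.2 :=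
    hm.comp (measurable_fst.prodMk measurable_snd.snd)
  have hT : Measurable fun ω => (Z ω, X ω, Y ω) := hZ.prodMk (hX.prodMk hY)
  have := Measure.isProbabilityMeasure_map (μ := μ) hZ.aemeasurable
  have := Measure.isProbabilityMeasure_map (μ := μ) hT.aemeasurable
  have hψ' : Measurable fun p : γ × α × β => ψ (p.1, p.2.2) :=
    hψ.comp (measurable_fst.prodMk measurable_snd.snd)
  have hsm : Measurable fun p : γ × α × β => φ p - ψ (p.1, p.2.2) := hφ.sub hψ'
  obtain ⟨hac, hfin, hllr⟩ := h.llr_eq hX hY hZ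
  have hmap : ∫ ω, φ (Z ω, X ω, Y ω) - ψ (Z ω, Y ω) ∂μ =
      ∫ p, φ p - ψ (p.1, p.2.2) ∂(μ.map fun ω => (Z ω, X ω, Y ω)) :=
    (integral_map hT.aemeasurable hsm.aestronglyMeasurable).symm
  rw [condMutualInfo, hmap]
  refine klDiv_le_of_llr_eq hac
    ((integrable_map_measure hsm.aestronglyMeasurable hT.aemeasurable).2 hint)
    (ρ := fun p => ENNReal.ofReal (Real.exp (ψ (p.1, p.2.2))) / mixtureDensity X Z μ φ p.1 p.2.2)
    (by fun_prop) ?_ ?_ ?_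
  · filter_upwards [hfin] with p hp
    simpa [ENNReal.div_eq_zero_iff, Real.exp_pos] using hp
  -- the channel density averages to `p` over `X`, which cancels the denominator of `exp ψ / p`
  · rw [h.map_eq_withDensity hX hY hZ,
      lintegral_withDensity_eq_lintegral_mul _ (by fun_prop) (by fun_prop),
      Measure.lintegral_compProd (by fun_prop)]
    calc _ ≤ ∫⁻ _, 1 ∂(μ.map Z) := lintegral_mono fun z => ?_
      _ = 1 := by simp
    have hmz : Measurable (mixtureDensity X Z μ φ z) := by fun_prop
    rw [Kernel.prod_apply, lintegral_prod _ (by fun_prop), lintegral_lintegral_swap (by fun_prop)]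
    refine le_trans (lintegral_mono fun y => ?_) (hψ1 z)
    simp only [Pi.mul_apply]
    rw [lintegral_mul_const _ (by fun_prop)]
    exact ENNReal.mul_div_le
  · filter_upwards [hllr, hfin] with p hp hpt
    have hpos := ENNReal.toReal_pos (mixtureDensity_ne_zero (X := X) (Z := Z) (μ := μ) hφ p.1 p.2.2)
      hpt
    rw [hp, ENNReal.toReal_div, ENNReal.toReal_ofReal (Real.exp_pos _).le,
      Real.log_div (Real.exp_pos _).ne' hpos.ne', Real.log_exp]
    ring

/-- Equality case of the golden formula: `exp (ψ (z, ·))` is the conditional density of `Y` given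
`Z = z`. -/
theorem condMutualInfo_eq (h : HasChannelLogDensity X Y Z μ η φ) (hX : Measurable X)
    (hY : Measurable Y) (hZ : Measurable Z) {ψ : γ × β → ℝ} (hψ : Measurable ψ)
    (hψm : ∀ᵐ z ∂(μ.map Z), ∀ y,
      mixtureDensity X Z μ φ z y = ENNReal.ofReal (Real.exp (ψ (z, y))))
    (hint : Integrable (fun ω => φ (Z ω, X ω, Y ω) - ψ (Z ω, Y ω)) μ) :
    condMutualInfo X Y Z μ = ENNReal.ofReal (∫ ω, φ (Z ω, X ω, Y ω) - ψ (Z ω, Y ω) ∂μ) := by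
  have hφ := h.measurable
  have hT : Measurable fun ω => (Z ω, X ω, Y ω) := hZ.prodMk (hX.prodMk hY)
  have := Measure.isProbabilityMeasure_map (μ := μ) hZ.aemeasurable
  have := Measure.isProbabilityMeasure_map (μ := μ) hT.aemeasurable
  have hψ' : Measurable fun p : γ × α × β => ψ (p.1, p.2.2) :=
    hψ.comp (measurable_fst.prodMk measurable_snd.snd)
  have hsm : Measurable fun p : γ × α × β => φ p - ψ (p.1, p.2.2) := hφ.sub hψ'
  obtain ⟨hac, hfin, hllr⟩ := h.llr_eq hX hY hZ
  have hmap : ∫ ω, φ (Z ω, X ω, Y ω) - ψ (Z ω, Y ω) ∂μ =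
      ∫ p, φ p - ψ (p.1, p.2.2) ∂(μ.map fun ω => (Z ω, X ω, Y ω)) :=
    (integral_map hT.aemeasurable hsm.aestronglyMeasurable).symm
  have hψm' : ∀ᵐ p ∂(μ.map fun ω => (Z ω, X ω, Y ω)), ∀ y,
      mixtureDensity X Z μ φ p.1 y = ENNReal.ofReal (Real.exp (ψ (p.1, y))) := by
    have : μ.map Z = (μ.map fun ω => (Z ω, X ω, Y ω)).map Prod.fst := by
      rw [Measure.map_map measurable_fst hT]; rfl
    rw [this] at hψm
    exact ae_of_ae_map measurable_fst.aemeasurable hψm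
  have hllr' : llr (μ.map (fun ω => (Z ω, X ω, Y ω)))
      ((μ.map Z) ⊗ₘ ((condDistrib X Z μ) ×ₖ (condDistrib Y Z μ)))
      =ᵐ[μ.map fun ω => (Z ω, X ω, Y ω)] fun p => φ p - ψ (p.1, p.2.2) := by
    filter_upwards [hllr, hψm'] with p hp hq
    rw [hp, hq, ENNReal.toReal_ofReal (Real.exp_pos _).le, Real.log_exp]
  have hint' := (integrable_map_measure hsm.aestronglyMeasurable hT.aemeasurable).2 hint
  rw [condMutualInfo, hmap, InformationTheory.klDiv_of_ac_of_integrable hac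
    ((integrable_congr hllr').2 hint'), integral_congr_ae hllr']
  simp

end HasChannelLogDensity

end Channel

/-! ### Gaussian densities -/

lemma gaussianReal_eq_withDensity_exp (c : ℝ) {v : ℝ≥0} (hv : v ≠ 0) :
    gaussianReal c v = (gaussianReal 0 v).withDensity
      (fun z => ENNReal.ofReal (Real.exp (c * z / v - c ^ 2 / (2 * v)))) := by
  have hv' : (v : ℝ) ≠ 0 := by exact_mod_cast hv
  rw [gaussianReal_of_var_ne_zero _ hv, gaussianReal_of_var_ne_zero _ hv,
    ← withDensity_mul _ (measurable_gaussianPDF 0 v) (by fun_prop)]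
  congr 1
  funext z
  simp only [Pi.mul_apply, gaussianPDF, gaussianPDFReal]
  rw [← ENNReal.ofReal_mul (by positivity), mul_assoc (√(2 * Real.pi * v))⁻¹, ← Real.exp_add]
  congr 3
  field_simp
  ring

lemma pi_withDensity {ι : Type*} [Fintype ι] {E : ι → Type*} [∀ i, MeasurableSpace (E i)]
    (μ : ∀ i, Measure (E i)) [∀ i, IsProbabilityMeasure (μ i)] {f : ∀ i, E i → ℝ≥0∞}
    (hf : ∀ i, Measurable (f i)) [∀ i, SigmaFinite ((μ i).withDensity (f i))] :
    Measure.pi (fun i => (μ i).withDensity (f i)) =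
      (Measure.pi μ).withDensity (fun x => ∏ i, f i (x i)) := by
  refine Measure.pi_eq fun s hs => ?_
  have hind : ∀ i, Measurable ((s i).indicator (f i)) := fun i => (hf i).indicator (hs i)
  have hprod : (Set.univ.pi s).indicator (fun x : ∀ i, E i => ∏ i, f i (x i)) =
      fun x => ∏ i, (s i).indicator (f i) (x i) := by
    funext x
    by_cases hx : x ∈ Set.univ.pi s
    · rw [Set.indicator_of_mem hx]
      exact Finset.prod_congr rfl fun i _ => (Set.indicator_of_mem (hx i trivial) _).symm
    · rw [Set.indicator_of_notMem hx]
      simp only [Set.mem_univ_pi, not_forall] at hx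
      obtain ⟨i, hi⟩ := hx
      exact (Finset.prod_eq_zero (Finset.mem_univ i) (Set.indicator_of_notMem hi _)).symm
  rw [withDensity_apply _ (MeasurableSet.univ_pi hs),
    ← lintegral_indicator (MeasurableSet.univ_pi hs),
    hprod, lintegral_prod_eq_prod_lintegral_of_indepFun Finset.univ
      (fun i (x : ∀ i, E i) => (s i).indicator (f i) (x i))
      (iIndepFun_pi fun i => (hind i).aemeasurable) (fun i => (hind i).comp (measurable_pi_apply i))]
  refine Finset.prod_congr rfl fun i _ => ?_
  rw [withDensity_apply _ (hs i), ← lintegral_indicator (hs i),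
    ← (measurePreserving_eval μ i).lintegral_comp (hind i)]

/-- The log-density at `y` of the product of the Gaussians `N(c j, v j)` with respect to the
product of the Gaussians `N(0, v j)`. -/
def gaussianShiftLog {ι : Type*} [Fintype ι] (v : ι → ℝ≥0) (c y : ι → ℝ) : ℝ :=
  ∑ j, (c j * y j / v j - c j ^ 2 / (2 * v j))

/-- Cameron-Martin formula for a product of centered Gaussians. -/
lemma map_add_pi_gaussianReal {ι : Type*} [Fintype ι] {v : ι → ℝ≥0} (hv : ∀ j, v j ≠ 0)
    (c : ι → ℝ) :
    (Measure.pi fun j => gaussianReal 0 (v j)).map (fun z => c + z) =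
      (Measure.pi fun j => gaussianReal 0 (v j)).withDensity
        (fun y => ENNReal.ofReal (Real.exp (gaussianShiftLog v c y))) := by
  have h1 : (Measure.pi fun j => gaussianReal 0 (v j)).map (fun z => c + z) =
      Measure.pi fun j => gaussianReal (c j) (v j) := by
    have := Measure.pi_map_pi (μ := fun j => gaussianReal 0 (v j)) (f := fun j x => c j + x)
      (fun j => by fun_prop)
    simp only [gaussianReal_map_const_add, zero_add] at this
    exact this
  have hd : ∀ j, gaussianReal (c j) (v j) = (gaussianReal 0 (v j)).withDensity
      (fun z => ENNReal.ofReal (Real.exp (c j * z / v j - c j ^ 2 / (2 * v j)))) :=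
    fun j => gaussianReal_eq_withDensity_exp (c j) (hv j)
  have : ∀ j, SigmaFinite ((gaussianReal 0 (v j)).withDensity
      (fun z => ENNReal.ofReal (Real.exp (c j * z / v j - c j ^ 2 / (2 * v j))))) :=
    fun j => hd j ▸ inferInstance
  rw [h1]
  simp_rw [hd]
  rw [pi_withDensity _ (fun j => by fun_prop)]
  congr 1
  funext y
  rw [gaussianShiftLog, Real.exp_sum, ENNReal.ofReal_prod_of_nonneg fun j _ => (Real.exp_pos _).le]

/-- Gaussian average of the likelihood of a signal of amplitude `x`, score `τ` and unit-power
signal-to-noise ratio `s`. The variance `P = 0` is included, both sides being `1`. -/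
lemma lintegral_exp_quadratic_gaussianReal (P : ℝ≥0) {s : ℝ} (hs : 0 ≤ s) (τ : ℝ) :
    ∫⁻ x, ENNReal.ofReal (Real.exp (x * τ - x ^ 2 * s / 2)) ∂(gaussianReal 0 P) =
      ENNReal.ofReal (Real.exp (P * τ ^ 2 / (2 * (1 + P * s)) - Real.log (1 + P * s) / 2)) := by
  by_cases hP : P = 0
  · simp [hP]
  have hP' : (0 : ℝ) < P := by exact_mod_cast pos_iff_ne_zero.2 hP
  have hk : 0 < 1 + P * s := by positivity
  -- completing the square: the integrand is a multiple of the density of `N(P τ / k, P / k)`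
  set k : ℝ := 1 + P * s with hkdef
  set w : ℝ≥0 := P / k.toNNReal with hw
  have hwr : (w : ℝ) = P / k := by simp [hw, Real.coe_toNNReal _ hk.le]
  have hw0 : w ≠ 0 := by
    rw [← NNReal.coe_ne_zero, hwr]; positivity
  rw [gaussianReal_of_var_ne_zero _ hP, lintegral_withDensity_eq_lintegral_mul _
    (measurable_gaussianPDF 0 P) (by fun_prop)]
  have key : ∀ x, (gaussianPDF 0 P * fun x =>
      ENNReal.ofReal (Real.exp (x * τ - x ^ 2 * s / 2))) x =
      ENNReal.ofReal (Real.exp (P * τ ^ 2 / (2 * k) - Real.log k / 2)) *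
        gaussianPDF (P * τ / k) w x := by
    intro x
    simp only [Pi.mul_apply, gaussianPDF, gaussianPDFReal]
    rw [← ENNReal.ofReal_mul (by positivity), ← ENNReal.ofReal_mul (by positivity)]
    congr 1
    have hsq : √(2 * Real.pi * w) = √(2 * Real.pi * P) / √k := by
      rw [hwr, ← mul_div_assoc, Real.sqrt_div (by positivity)]
    have hlog : Real.exp (Real.log k / 2) = √k := by
      rw [Real.exp_half, Real.exp_log hk]
    rw [hsq, Real.exp_sub _ (Real.log k / 2), hlog, mul_assoc, ← Real.exp_add]
    have hkne : √k ≠ 0 := (Real.sqrt_pos.2 hk).ne'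
    have hexp : -(x - 0) ^ 2 / (2 * P) + (x * τ - x ^ 2 * s / 2) =
        P * τ ^ 2 / (2 * k) + -(x - P * τ / k) ^ 2 / (2 * w) := by
      rw [hwr]
      field_simp
      rw [hkdef]
      ring
    rw [hexp, Real.exp_add]
    field_simp
  simp_rw [key]
  rw [lintegral_const_mul _ (measurable_gaussianPDF _ _), lintegral_gaussianPDF_eq_one _ hw0,
    mul_one]

/-! ### The score of a signal in Gaussian noise -/

section Score

variable {ι : Type*} [Fintype ι]

/-- The score `∑ j, a j * y j / v j` of a signal `x • a` observed in independent Gaussian noises of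
variances `v j`: a sufficient statistic for `x`. -/
def gaussianScore (v : ι → ℝ≥0) (a y : ι → ℝ) : ℝ := ∑ j, a j * y j / v j

lemma gaussianShiftLog_add_smul (v : ι → ℝ≥0) (a b y : ι → ℝ) (x : ℝ) :
    gaussianShiftLog v (b + x • a) y = gaussianShiftLog v b y +
      (x * gaussianScore v a (y - b) - x ^ 2 * gaussianScore v a a / 2) := by
  simp only [gaussianShiftLog, gaussianScore, Finset.mul_sum, Finset.sum_div,
    ← Finset.sum_add_distrib, ← Finset.sum_sub_distrib]
  refine Finset.sum_congr rfl fun j _ => ?_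
  simp only [Pi.add_apply, Pi.smul_apply, Pi.sub_apply, smul_eq_mul]
  by_cases h : (v j : ℝ) = 0
  · simp [h]
  field_simp
  ring

lemma gaussianScore_smul_add (v : ι → ℝ≥0) (a z : ι → ℝ) (x : ℝ) :
    gaussianScore v a (x • a + z) = x * gaussianScore v a a + gaussianScore v a z := by
  simp only [gaussianScore, Finset.mul_sum, ← Finset.sum_add_distrib]
  refine Finset.sum_congr rfl fun j _ => ?_
  simp only [Pi.add_apply, Pi.smul_apply, smul_eq_mul]
  ring

lemma gaussianScore_self_nonneg (v : ι → ℝ≥0) (a : ι → ℝ) : 0 ≤ gaussianScore v a a :=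
  Finset.sum_nonneg fun j _ => div_nonneg (mul_self_nonneg _) (v j).2

lemma memLp_gaussianScore (v : ι → ℝ≥0) (a : ι → ℝ) :
    MemLp (gaussianScore v a) 2 (Measure.pi fun j => gaussianReal 0 (v j)) := by
  unfold gaussianScore
  refine memLp_finsetSum _ fun j _ => ?_
  have h : MemLp (fun y : ℝ => a j * y / v j) 2 (gaussianReal 0 (v j)) := by
    have := (memLp_id_gaussianReal' (μ := 0) (v := v j) 2 (by simp)).mul_const (a j / v j)
    refine this.congr_norm (by fun_prop) (ae_of_all _ fun y => ?_)
    rw [id, mul_comm (a j), mul_div_assoc]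
  exact h.comp_measurePreserving (measurePreserving_eval (fun j => gaussianReal 0 (v j)) j)

lemma integral_gaussianScore (v : ι → ℝ≥0) (a : ι → ℝ) :
    ∫ z, gaussianScore v a z ∂(Measure.pi fun j => gaussianReal 0 (v j)) = 0 := by
  unfold gaussianScore
  rw [integral_finsetSum]
  · refine Finset.sum_eq_zero fun j _ => ?_
    rw [integral_div, integral_const_mul,
      integral_comp_eval (μ := fun j => gaussianReal 0 (v j)) (f := fun y : ℝ => y)
      (by fun_prop)]
    simp
  · intro j _
    exact ((integrable_comp_eval (μ := fun j => gaussianReal 0 (v j)) (f := fun y : ℝ => y)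
      ((memLp_id_gaussianReal' (μ := 0) (v := v j) 1 (by simp)).integrable le_rfl)).const_mul
      (a j)).div_const _

lemma integral_gaussianScore_sq {v : ι → ℝ≥0} (hv : ∀ j, v j ≠ 0) (a : ι → ℝ) :
    ∫ z, gaussianScore v a z ^ 2 ∂(Measure.pi fun j => gaussianReal 0 (v j)) =
      gaussianScore v a a := by
  rw [← variance_of_integral_eq_zero (memLp_gaussianScore v a).aestronglyMeasurable.aemeasurable
    (integral_gaussianScore v a)]
  have h : ∀ j, MemLp (fun y : ℝ => (a j / v j) * y) 2 (gaussianReal 0 (v j)) := fun j =>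
    (memLp_id_gaussianReal' (μ := 0) (v := v j) 2 (by simp)).const_mul (a j / v j)
  have h2 : gaussianScore v a = ∑ j, fun z : ι → ℝ => (a j / v j) * z j := by
    funext z
    simp only [gaussianScore, Finset.sum_apply]
    exact Finset.sum_congr rfl fun j _ => by ring
  rw [h2, variance_sum_pi h, ← h2]
  refine Finset.sum_congr rfl fun j _ => ?_
  have : (v j : ℝ) ≠ 0 := by exact_mod_cast hv j
  rw [variance_const_mul, variance_fun_id_gaussianReal]
  field_simp

end Score

/-! ### The channel from the source to all other nodes -/

lemma measurable_sourceInput {r : ℕ} : Measurable (sourceInput (r := r)) :=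
  measurable_pi_apply 0

lemma measurable_relayInputs {r : ℕ} : Measurable (relayInputs (r := r)) :=
  measurable_pi_iff.2 fun k => measurable_pi_apply k.succ

namespace GaussianMRC

variable {r : ℕ} (C : GaussianMRC r)

/-- The amplitudes with which the source is heard at the receiving nodes. No receiving node is the
source, so the exclusion `i ≠ j` in the definition of `output` never applies to the source. -/
def sourceGain : Fin (r + 1) → ℝ := fun j => √(C.gain (Fin.castSucc 0) j.succ)

/-- The part of the received signals that is due to the relay inputs `w`. -/
def relaySignal (w : Fin r → ℝ) : Fin (r + 1) → ℝ := fun j =>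
  ∑ k : Fin r, if k.succ.castSucc ≠ j.succ then √(C.gain k.succ.castSucc j.succ) * w k else 0

lemma measurable_relaySignal : Measurable C.relaySignal := by
  refine measurable_pi_iff.2 fun j => Finset.measurable_sum _ fun k _ => ?_
  split_ifs <;> fun_prop

lemma output_eq (x z : Fin (r + 1) → ℝ) :
    C.output x z = (C.relaySignal (relayInputs x) + sourceInput x • C.sourceGain) + z := by
  funext j
  have h0 : (Fin.castSucc (0 : Fin (r + 1))) ≠ j.succ := by
    rw [Fin.castSucc_zero]; exact (Fin.succ_ne_zero j).symm
  simp only [output, Finset.sum_filter, Fin.sum_univ_succ, if_pos h0, relaySignal, sourceGain,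
    relayInputs, sourceInput, Pi.add_apply, Pi.smul_apply, smul_eq_mul]
  ring

lemma noiseVar_ne_zero (j : Fin (r + 1)) : C.noiseVar j ≠ 0 := (C.noiseVar_pos j).ne'

lemma measurable_output :
    Measurable fun p : (Fin (r + 1) → ℝ) × (Fin (r + 1) → ℝ) => C.output p.1 p.2 := by
  refine measurable_pi_iff.2 fun j => ?_
  unfold output
  fun_prop

/-- The signal-to-noise ratio, per unit of source power, of the cut that separates the source from
all other nodes. -/
def cutSNR : ℝ := gaussianScore C.noiseVar C.sourceGain C.sourceGain

lemma cutSNR_nonneg : 0 ≤ C.cutSNR := gaussianScore_self_nonneg _ _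

/-- The log-density of the received signals with respect to the noise law, given the relay inputs
and the source input. -/
def channelLog (p : (Fin r → ℝ) × ℝ × (Fin (r + 1) → ℝ)) : ℝ :=
  gaussianShiftLog C.noiseVar (C.relaySignal p.1 + p.2.1 • C.sourceGain) p.2.2

/-- The log-density of the received signals with respect to the noise law, given the relay inputs,
when the source input is an independent `N(0, P)`. -/
def gaussianMixtureLog (P : ℝ≥0) (p : (Fin r → ℝ) × (Fin (r + 1) → ℝ)) : ℝ :=
  gaussianShiftLog C.noiseVar (C.relaySignal p.1) p.2 +
    (P * gaussianScore C.noiseVar C.sourceGain (p.2 - C.relaySignal p.1) ^ 2 /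
      (2 * (1 + P * C.cutSNR)) - Real.log (1 + P * C.cutSNR) / 2)

lemma measurable_channelLog : Measurable C.channelLog := by
  have := C.measurable_relaySignal
  unfold channelLog gaussianShiftLog
  simp only [Pi.add_apply, Pi.smul_apply, smul_eq_mul]
  fun_prop

lemma measurable_gaussianMixtureLog (P : ℝ≥0) : Measurable (C.gaussianMixtureLog P) := by
  have := C.measurable_relaySignal
  unfold gaussianMixtureLog gaussianShiftLog gaussianScore
  simp only [Pi.sub_apply]
  fun_prop

lemma noise_map_add (c : Fin (r + 1) → ℝ) :
    C.noise.map (fun z => c + z) = C.noise.withDensity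
      (fun y => ENNReal.ofReal (Real.exp (gaussianShiftLog C.noiseVar c y))) :=
  map_add_pi_gaussianReal C.noiseVar_ne_zero c

lemma lintegral_exp_channelLog (w : Fin r → ℝ) (x : ℝ) :
    ∫⁻ y, ENNReal.ofReal (Real.exp (C.channelLog (w, x, y))) ∂C.noise = 1 := by
  have h := congrArg (fun m => m Set.univ) (C.noise_map_add (C.relaySignal w + x • C.sourceGain))
  simp only [Measure.map_apply (measurable_const_add _) MeasurableSet.univ, Set.preimage_univ,
    measure_univ, withDensity_apply _ MeasurableSet.univ, Measure.restrict_univ] at h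
  exact h.symm

lemma hasChannelLogDensity (ν : Measure (Fin (r + 1) → ℝ)) [IsProbabilityMeasure ν] :
    HasChannelLogDensity (fun p => sourceInput p.1) (fun p => C.output p.1 p.2)
      (fun p => relayInputs p.1) (ν.prod C.noise) C.noise C.channelLog where
  measurable := C.measurable_channelLog
  lintegral_exp := C.lintegral_exp_channelLog
  lintegral_comp g hg := by
    have hs := measurable_sourceInput (r := r)
    have hr := measurable_relayInputs (r := r)
    have ho := C.measurable_output
    have hc := C.measurable_channelLog
    have hinner : Measurable fun p : (Fin (r + 1) → ℝ) × (Fin (r + 1) → ℝ) =>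
        ∫⁻ y, g (relayInputs p.1, sourceInput p.1, y) *
          ENNReal.ofReal (Real.exp (C.channelLog (relayInputs p.1, sourceInput p.1, y))) ∂C.noise :=
      Measurable.lintegral_prod_right'
        (f := fun q : ((Fin (r + 1) → ℝ) × (Fin (r + 1) → ℝ)) × (Fin (r + 1) → ℝ) =>
          g (relayInputs q.1.1, sourceInput q.1.1, q.2) *
          ENNReal.ofReal (Real.exp (C.channelLog (relayInputs q.1.1, sourceInput q.1.1, q.2))))
        (by fun_prop)
    rw [lintegral_prod _ (by fun_prop), lintegral_prod _ hinner.aemeasurable]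
    refine lintegral_congr fun x => ?_
    simp only [lintegral_const, measure_univ, mul_one, C.output_eq]
    have hgx : Measurable fun y => g (relayInputs x, sourceInput x, y) := by fun_prop
    rw [← lintegral_map (f := fun y => g (relayInputs x, sourceInput x, y)) hgx
      (measurable_const_add _), C.noise_map_add,
      lintegral_withDensity_eq_lintegral_mul _ (by unfold gaussianShiftLog; fun_prop) hgx]
    exact lintegral_congr fun y => mul_comm _ _

lemma lintegral_exp_channelLog_gaussianReal (P : ℝ≥0) (w : Fin r → ℝ) (y : Fin (r + 1) → ℝ) :
    ∫⁻ x, ENNReal.ofReal (Real.exp (C.channelLog (w, x, y))) ∂(gaussianReal 0 P) =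
      ENNReal.ofReal (Real.exp (C.gaussianMixtureLog P (w, y))) := by
  simp only [channelLog, gaussianMixtureLog, gaussianShiftLog_add_smul, Real.exp_add,
    ENNReal.ofReal_mul (Real.exp_pos _).le]
  rw [lintegral_const_mul _ (by fun_prop)]
  congr 1
  exact lintegral_exp_quadratic_gaussianReal P C.cutSNR_nonneg _

lemma lintegral_exp_gaussianMixtureLog (P : ℝ≥0) (w : Fin r → ℝ) :
    ∫⁻ y, ENNReal.ofReal (Real.exp (C.gaussianMixtureLog P (w, y))) ∂C.noise = 1 := by
  have := C.measurable_channelLog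
  simp_rw [← C.lintegral_exp_channelLog_gaussianReal P w]
  rw [lintegral_lintegral_swap (by fun_prop)]
  simp [C.lintegral_exp_channelLog]

lemma channelLog_sub_gaussianMixtureLog (P : ℝ≥0) (x z : Fin (r + 1) → ℝ) :
    C.channelLog (relayInputs x, sourceInput x, C.output x z) -
      C.gaussianMixtureLog P (relayInputs x, C.output x z) =
    Real.log (1 + P * C.cutSNR) / 2 + (C.cutSNR / (2 * (1 + P * C.cutSNR)) * x 0 ^ 2 +
      (1 / (1 + P * C.cutSNR) * (x 0 * gaussianScore C.noiseVar C.sourceGain z) -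
      P / (2 * (1 + P * C.cutSNR)) * gaussianScore C.noiseVar C.sourceGain z ^ 2)) := by
  have hs := C.cutSNR_nonneg
  have hk : 0 < 1 + P * C.cutSNR := by positivity
  have hy : C.output x z - C.relaySignal (relayInputs x) = sourceInput x • C.sourceGain + z := by
    rw [C.output_eq]; abel
  simp only [channelLog, gaussianMixtureLog, gaussianShiftLog_add_smul, hy, gaussianScore_smul_add,
    sourceInput]
  rw [← cutSNR]
  field_simp
  ring

/-! ### The maximal information across the cut -/

/-- The expected log-ratio in the golden formula depends on the input law only through the source
power `E[X_1 ^ 2]`. -/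
lemma integral_channelLog_sub (P : ℝ≥0) (ν : Measure (Fin (r + 1) → ℝ)) [IsProbabilityMeasure ν]
    (hν : Integrable (fun x => x 0 ^ 2) ν) :
    Integrable (fun p : (Fin (r + 1) → ℝ) × (Fin (r + 1) → ℝ) =>
      C.channelLog (relayInputs p.1, sourceInput p.1, C.output p.1 p.2) -
        C.gaussianMixtureLog P (relayInputs p.1, C.output p.1 p.2)) (ν.prod C.noise) ∧
    ∫ p : (Fin (r + 1) → ℝ) × (Fin (r + 1) → ℝ),
      C.channelLog (relayInputs p.1, sourceInput p.1, C.output p.1 p.2) -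
        C.gaussianMixtureLog P (relayInputs p.1, C.output p.1 p.2) ∂(ν.prod C.noise) =
    Real.log (1 + P * C.cutSNR) / 2 +
      C.cutSNR / (2 * (1 + P * C.cutSNR)) * (∫ x, x 0 ^ 2 ∂ν - P) := by
  simp only [C.channelLog_sub_gaussianMixtureLog P]
  have hT2 : MemLp (gaussianScore C.noiseVar C.sourceGain) 2 C.noise := memLp_gaussianScore _ _
  have hX2 : MemLp (fun x : Fin (r + 1) → ℝ => x 0) 2 ν :=
    (memLp_two_iff_integrable_sq (measurable_pi_apply 0).aestronglyMeasurable).2 hν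
  have hT : Integrable (gaussianScore C.noiseVar C.sourceGain) C.noise := hT2.integrable one_le_two
  have hX : Integrable (fun x : Fin (r + 1) → ℝ => x 0) ν := hX2.integrable one_le_two
  have i1 := (hν.comp_fst C.noise).const_mul (C.cutSNR / (2 * (1 + P * C.cutSNR)))
  have i2 := (hX.mul_prod hT).const_mul (1 / (1 + P * C.cutSNR))
  have i3 := (hT2.integrable_sq.comp_snd ν).const_mul (P / (2 * (1 + P * C.cutSNR)))
  have i0 : Integrable (fun _ : (Fin (r + 1) → ℝ) × (Fin (r + 1) → ℝ) =>
    Real.log (1 + P * C.cutSNR) / 2) (ν.prod C.noise) := integrable_const _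
  have e1 : ∫ p : (Fin (r + 1) → ℝ) × (Fin (r + 1) → ℝ), p.1 0 ^ 2 ∂(ν.prod C.noise) =
      ∫ x, x 0 ^ 2 ∂ν := by
    simpa using integral_fun_fst (μ := ν) (ν := C.noise) (fun x : Fin (r + 1) → ℝ => x 0 ^ 2)
  have e2 : ∫ p : (Fin (r + 1) → ℝ) × (Fin (r + 1) → ℝ),
      p.1 0 * gaussianScore C.noiseVar C.sourceGain p.2 ∂(ν.prod C.noise) = 0 := by
    rw [integral_prod_mul (fun x : Fin (r + 1) → ℝ => x 0), noise, integral_gaussianScore, mul_zero]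
  have e3 : ∫ p : (Fin (r + 1) → ℝ) × (Fin (r + 1) → ℝ),
      gaussianScore C.noiseVar C.sourceGain p.2 ^ 2 ∂(ν.prod C.noise) = C.cutSNR := by
    have := integral_fun_snd (μ := ν) (ν := C.noise)
      (fun z => gaussianScore C.noiseVar C.sourceGain z ^ 2)
    rw [noise, integral_gaussianScore_sq C.noiseVar_ne_zero, ← noise] at this
    simpa [cutSNR] using this
  have i23 := i2.sub i3
  refine ⟨i0.add (i1.add i23), (integral_add i0 (i1.add i23)).trans ?_⟩
  rw [integral_add' i1 i23, integral_sub' i2 i3, integral_const_mul, integral_const_mul,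
    integral_const_mul, e1, e2, e3]
  simp
  ring

/-- The upper bound `log (1 + P * cutSNR) / 2` holds for every joint input law with source power at
most `P`, whatever the relay inputs and their dependence on the source. -/
lemma cutInfo_le (P : ℝ≥0) (ν : Measure (Fin (r + 1) → ℝ)) [IsProbabilityMeasure ν]
    (hν : Integrable (fun x => x 0 ^ 2) ν) (hP : ∫ x, x 0 ^ 2 ∂ν ≤ P) :
    C.cutInfo ν ≤ ENNReal.ofReal (Real.log (1 + P * C.cutSNR) / 2) := by
  have hs := C.cutSNR_nonneg
  obtain ⟨hi, he⟩ := C.integral_channelLog_sub P ν hν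
  refine ((C.hasChannelLogDensity ν).condMutualInfo_le
    (measurable_sourceInput.comp measurable_fst) C.measurable_output
    (measurable_relayInputs.comp measurable_fst) (C.measurable_gaussianMixtureLog P)
    (fun w => (C.lintegral_exp_gaussianMixtureLog P w).le) hi).trans ?_
  refine ENNReal.ofReal_le_ofReal ?_
  rw [he]
  have : C.cutSNR / (2 * (1 + P * C.cutSNR)) * (∫ x, x 0 ^ 2 ∂ν - P) ≤ 0 :=
    mul_nonpos_of_nonneg_of_nonpos (by positivity) (by linarith)
  linarith

/-- An independent `N(0, P)` source reaches the upper bound: the conditional law of the outputs given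
the relay inputs is then the Gaussian mixture used in the golden formula. -/
lemma cutInfo_eq (P : ℝ≥0) (μ : Measure (Fin (r + 1) → ℝ)) [IsProbabilityMeasure μ]
    (hlaw : μ.map sourceInput = gaussianReal 0 P) (hind : IndepFun sourceInput relayInputs μ) :
    C.cutInfo μ = ENNReal.ofReal (Real.log (1 + P * C.cutSNR) / 2) := by
  have hs := measurable_sourceInput (r := r)
  have hr := measurable_relayInputs (r := r)
  have hsq : MemLp id 2 (μ.map sourceInput) := hlaw ▸ memLp_id_gaussianReal' 2 (by simp)
  have hsq' : MemLp (fun x : Fin (r + 1) → ℝ => x 0) 2 μ :=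
    (memLp_map_measure_iff hsq.aestronglyMeasurable hs.aemeasurable).1 hsq
  have hpow : ∫ x, x 0 ^ 2 ∂μ = P := by
    have h : ∫ x, x ^ 2 ∂(gaussianReal 0 P) = P := by
      rw [← variance_of_integral_eq_zero (by fun_prop) integral_id_gaussianReal,
        variance_fun_id_gaussianReal]
    rw [← h, ← hlaw, integral_map hs.aemeasurable (by fun_prop)]
    rfl
  obtain ⟨hi, he⟩ := C.integral_channelLog_sub P μ hsq'.integrable_sq
  have hcond : condDistrib (sourceInput (r := r)) relayInputs μ =ᵐ[μ.map relayInputs]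
      Kernel.const _ (gaussianReal 0 P) := by
    refine condDistrib_ae_eq_of_measure_eq_compProd _ hs.aemeasurable ?_
    rw [Measure.compProd_const, ← hlaw]
    exact (indepFun_iff_map_prod_eq_prod_map_map hr.aemeasurable hs.aemeasurable).1 hind.symm
  have hmap : (μ.prod C.noise).map (fun p => relayInputs p.1) = μ.map relayInputs := by
    change (μ.prod C.noise).map (relayInputs ∘ Prod.fst) = _
    rw [← Measure.map_map hr measurable_fst, Measure.map_fst_prod]
    simp
  rw [cutInfo, (C.hasChannelLogDensity μ).condMutualInfo_eq (hs.comp measurable_fst)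
    C.measurable_output (hr.comp measurable_fst) (C.measurable_gaussianMixtureLog P) ?_ hi, he, hpow]
  · simp
  rw [hmap]
  filter_upwards [condDistrib_fst_prod relayInputs hs.aemeasurable C.noise, hcond] with w h1 h2 y
  rw [mixtureDensity, h1, h2, Kernel.const_apply, C.lintegral_exp_channelLog_gaussianReal]

/-- Optimality depends on the source input alone; the relay inputs need not be Gaussian. -/
lemma attainsMax_of_source_gaussian (P : Fin (r + 1) → ℝ≥0) (μ : Measure (Fin (r + 1) → ℝ))
    [IsProbabilityMeasure μ] (hP : PowerConstraint P μ)
    (hlaw : μ.map sourceInput = gaussianReal 0 (P 0)) (hind : IndepFun sourceInput relayInputs μ) :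
    C.AttainsMax P μ := by
  have h := C.cutInfo_eq (P 0) μ hlaw hind
  exact ⟨hP, h ▸ ENNReal.ofReal_ne_top, fun ν _ hν => h ▸ C.cutInfo_le (P 0) ν (hν 0).1 (hν 0).2⟩

lemma integrable_sq_and_integral_sq_le_of_map_eq {Ω : Type*} [MeasurableSpace Ω] {μ : Measure Ω}
    {X : Ω → ℝ} (hX : Measurable X) {m p : ℝ} {v : ℝ≥0} (h : μ.map X = gaussianReal m v)
    (hp : m ^ 2 + v ≤ p) :
    Integrable (fun ω => X ω ^ 2) μ ∧ ∫ ω, X ω ^ 2 ∂μ ≤ p := by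
  have hL : MemLp id 2 (gaussianReal m v) := memLp_id_gaussianReal' 2 (by simp)
  have hint : Integrable (fun x : ℝ => x ^ 2) (μ.map X) := h ▸ hL.integrable_sq
  refine ⟨hint.comp_measurable hX, ?_⟩
  have hval : ∫ x, x ^ 2 ∂(gaussianReal m v) = m ^ 2 + v := by
    have := variance_eq_sub hL
    rw [variance_id_gaussianReal] at this
    simp only [Pi.pow_apply, id] at this
    rw [integral_id_gaussianReal] at this
    linarith
  rw [← integral_map hX.aemeasurable (f := fun x : ℝ => x ^ 2) (by fun_prop), h, hval]
  exact hp

lemma attainsMax_pi_gaussianReal (P : Fin (r + 1) → ℝ≥0) (m : Fin (r + 1) → ℝ)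
    (v : Fin (r + 1) → ℝ≥0) (hm : m 0 = 0) (hv : v 0 = P 0)
    (hmv : ∀ i, m i ^ 2 + v i ≤ (P i : ℝ)) :
    C.AttainsMax P (Measure.pi fun i => gaussianReal (m i) (v i)) := by
  have hev := fun i => (measurePreserving_eval (fun i => gaussianReal (m i) (v i)) i).map_eq
  refine C.attainsMax_of_source_gaussian P _
    (fun i => integrable_sq_and_integral_sq_le_of_map_eq (measurable_pi_apply i) (hev i) (hmv i))
    ?_ ?_
  · have := hev 0
    rwa [hm, hv] at this
  · have h := (iIndepFun_pi (μ := fun i => gaussianReal (m i) (v i)) (X := fun _ x => x)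
      fun i => aemeasurable_id).indepFun_finset {0} {0}ᶜ disjoint_compl_right
      fun i => measurable_pi_apply i
    exact h.comp (φ := fun y : ({0} : Finset (Fin (r + 1))) → ℝ => y ⟨0, by simp⟩)
      (ψ := fun (y : ({0}ᶜ : Finset (Fin (r + 1))) → ℝ) (k : Fin r) =>
        y ⟨k.succ, by simp⟩) (by fun_prop) (by fun_prop)

lemma attainsMax_correlatedRelayLaw (P : Fin (r + 1) → ℝ≥0) (S : Matrix (Fin r) (Fin r) ℝ)
    (hS : S.PosSemidef) (hSP : ∀ k, S k k ≤ P k.succ) :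
    C.AttainsMax P (correlatedRelayLaw (P 0) S) := by
  set f : ℝ × EuclideanSpace ℝ (Fin r) → Fin (r + 1) → ℝ :=
    fun q => Fin.cons q.1 (fun k => q.2 k) with hf
  have hfm : Measurable f := by
    refine measurable_pi_iff.2 fun i => ?_
    refine Fin.cases ?_ (fun k => ?_) i
    · simpa [f] using measurable_fst
    · simp only [f, Fin.cons_succ]
      fun_prop
  set ρ := (gaussianReal 0 (P 0)).prod (multivariateGaussian 0 S) with hρ
  have hlaw : correlatedRelayLaw (P 0) S = ρ.map f := rfl
  have h0 : (ρ.map f).map (fun x => x 0) = gaussianReal 0 (P 0) := by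
    rw [Measure.map_map (measurable_pi_apply 0) hfm]
    change ρ.map Prod.fst = _
    rw [hρ, Measure.map_fst_prod]
    simp
  have hk : ∀ k : Fin r, (ρ.map f).map (fun x => x k.succ) = gaussianReal 0 (S k k).toNNReal := by
    intro k
    rw [Measure.map_map (measurable_pi_apply k.succ) hfm]
    change ρ.map ((fun x : EuclideanSpace ℝ (Fin r) => x k) ∘ Prod.snd) = _
    rw [← Measure.map_map (by fun_prop) measurable_snd, hρ, Measure.map_snd_prod]
    simpa using (measurePreserving_eval_multivariateGaussian (μ := 0) hS (i := k)).map_eq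
  refine C.attainsMax_of_source_gaussian P _ ?_ ?_ ?_
  · intro i
    rw [hlaw]
    refine Fin.cases ?_ (fun k => ?_) i
    · exact integrable_sq_and_integral_sq_le_of_map_eq (measurable_pi_apply 0) h0 (by simp)
    · refine integrable_sq_and_integral_sq_le_of_map_eq (measurable_pi_apply k.succ) (hk k) ?_
      rw [Real.coe_toNNReal _ (hS.diag_nonneg)]
      simpa using hSP k
  · rw [hlaw]; exact h0
  · have h := indepFun_prod (μ := gaussianReal 0 (P 0)) (ν := multivariateGaussian 0 S)
      (X := id) (Y := fun (q : EuclideanSpace ℝ (Fin r)) (k : Fin r) => q k) measurable_id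
      (by fun_prop)
    rw [hlaw, indepFun_iff_map_prod_eq_prod_map_map measurable_sourceInput.aemeasurable
      measurable_relayInputs.aemeasurable, Measure.map_map measurable_sourceInput hfm,
      Measure.map_map measurable_relayInputs hfm,
      Measure.map_map (measurable_sourceInput.prodMk measurable_relayInputs) hfm]
    exact (indepFun_iff_map_prod_eq_prod_map_map (measurable_sourceInput.comp hfm).aemeasurable
      (measurable_relayInputs.comp hfm).aemeasurable).1 h

end GaussianMRC

end

theorem theorem1 (r : ℕ) (C : GaussianMRC r) (P : Fin (r + 1) → ℝ≥0) :
    -- Gaussian inputs, the source at full power and independent of the relays, are optimal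
    (∀ (μ : Measure (Fin (r + 1) → ℝ)) [IsProbabilityMeasure μ],
      GaussianMRC.PowerConstraint P μ →
      (∀ i, HasGaussianLaw (fun x : Fin (r + 1) → ℝ => x i) μ) →
      μ.map sourceInput = gaussianReal 0 (P 0) →
      IndepFun sourceInput relayInputs μ →
      C.AttainsMax P μ) ∧
    -- in particular fully independent Gaussian inputs
    (∀ (m : Fin (r + 1) → ℝ) (v : Fin (r + 1) → ℝ≥0),
      m 0 = 0 → v 0 = P 0 → (∀ i, m i ^ 2 + v i ≤ (P i : ℝ)) →
      C.AttainsMax P (Measure.pi fun i => gaussianReal (m i) (v i))) ∧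
    -- and jointly Gaussian relay inputs with any covariance matrix within the power constraints
    (∀ S : Matrix (Fin r) (Fin r) ℝ, S.PosSemidef → (∀ k, S k k ≤ P k.succ) →
      C.AttainsMax P (correlatedRelayLaw (P 0) S)) := by
  refine ⟨fun μ _ hP _ hlaw hind => C.attainsMax_of_source_gaussian P μ hP hlaw hind,
    fun m v hm hv hmv => C.attainsMax_pi_gaussianReal P m v hm hv hmv,
    fun S hS hSP => C.attainsMax_correlatedRelayLaw P S hS hSP⟩
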